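/- Let $R=\mathbb R[x,y,z]$ and, for $r\ge 0$, let $K(r)$ be the real vector space of homogeneous polynomials of degree $r$ in the ideal $$\bigl(\langle x^{r+1},(x+y)^{r+1}\rangle\cap\langle z^{r+1},(z+y)^{r+1}\rangle\bigr):y^{r+1}.$$ Let $n\ge 1$, let $r\in\{2n-1,2n\}$, and put $s=r-n+1$ (so $s=n$ if $r=2n-1$, and $s=n+1$ if $r=2n$). Define real matrices as follows: $\mathcal N$ is the $n\times n$ matrix with entries $\mathcal N_{ij}=\binom{r+1}{s+i-j}$; $\mathcal D$ is the $s\times s$ lower-triangular matrix with $\mathcal D_{ij}=\binom{r+1}{i-j}$ for $i\ge j$ and $\mathcal D_{ij}=0$ for $i<j$; $\mathcal J$ is the $s\times s$ exchange matrix (ones on the antidiagonal, zeros elsewhere). The matrix $\mathcal N$ is invertible. Let $\bar{\mathcal N}=\mathcal N^{-1}$ if $r=2n-1$, and let $\bar{\mathcal N}$ be the $(n+1)\times(n+1)$ matrix $$\bar{\mathcal N}=\begin{pmatrix}0&\mathcal N^{-1}\\-1&0\end{pmatrix}$$ (first column zero except for the last entry $-1$) if $r=2n$. Put $\mathcal U=\mathcal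 J\mathcal D\bar{\mathcal N}\mathcal D$, an $s\times s$ matrix. Then: 1. (Case $r=2n-1$.) $\dim_{\mathbb R} K(2n-1)=n$ if and only if for every real $n\times n$ matrix $C$ the equation $\mathcal UX-Y^T\mathcal U^T=C$ has a solution consisting of two upper-triangular real matrices $X,Y$. 2. (Case $r=2n$.) $\dim_{\mathbb R} K(2n)=n+1$ if and only if for every real $(n+1)\times(n+1)$ matrix $C$ the equation $\mathcal UX-Y^T\mathcal U^T=C$ has a solution consisting of two upper-triangular real matrices $X,Y$. -/

import Mathlib

open MvPolynomial Matrix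

noncomputable section

/-- The graded piece `K(r) = ((⟨x^{r+1}, (x+y)^{r+1}⟩ ∩ ⟨z^{r+1}, (z+y)^{r+1}⟩) : y^{r+1})_r` of
`ℝ[x,y,z]`, with `x = X 0`, `y = X 1`, `z = X 2`, as a real vector space. -/
def splineK (r : ℕ) : Submodule ℝ (MvPolynomial (Fin 3) ℝ) :=
  homogeneousSubmodule (Fin 3) ℝ r ⊓
    ((Ideal.span {X 0 ^ (r + 1), (X 0 + X 1) ^ (r + 1)} ⊓
      Ideal.span {X 2 ^ (r + 1), (X 2 + X 1) ^ (r + 1)} :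
        Ideal (MvPolynomial (Fin 3) ℝ)).colon {X 1 ^ (r + 1)}).restrictScalars ℝ

/-- The `s × s` exchange matrix `𝒥`, with ones exactly on the antidiagonal. -/
def exchangeMat (s : ℕ) : Matrix (Fin s) (Fin s) ℝ :=
  Matrix.of fun i j => if j = Fin.rev i then 1 else 0

/-- The `s × s` lower-triangular Toeplitz matrix `𝒟`, with entry `binom(r+1, i-j)` for `j ≤ i`. -/
def binomD (r s : ℕ) : Matrix (Fin s) (Fin s) ℝ :=
  Matrix.of fun i j =>
    if j ≤ i then ((r + 1).choose ((i : ℕ) - (j : ℕ)) : ℝ) else 0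

/-- The `n × n` Toeplitz matrix `𝒩` (for `r = 2n-1` or `r = 2n`) with entry
`binom(r+1, (r+1-n)+i-j)`; as `r + 1 - n ≥ n > j`, no subtraction truncates. -/
def binomN (r n : ℕ) : Matrix (Fin n) (Fin n) ℝ :=
  Matrix.of fun i j => ((r + 1).choose ((r + 1 - n) + (i : ℕ) - (j : ℕ)) : ℝ)

/-- The block matrix `𝒩' = [0, 𝒩⁻¹; -1, 0]` of size `n+1`, for `r = 2n`: the first column is zero
except for its last entry `-1`, the upper right `n × n` block is `𝒩⁻¹`, and the rest of the last
row is zero. -/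
def binomN' (n : ℕ) : Matrix (Fin (n + 1)) (Fin (n + 1)) ℝ :=
  Matrix.of fun i j =>
    Fin.lastCases (motive := fun _ => ℝ)
      (Fin.cases (motive := fun _ => ℝ) (-1) (fun _ => 0) j)
      (fun i' => Fin.cases (motive := fun _ => ℝ) 0 (fun j' => (binomN (2 * n) n)⁻¹ i' j') j) i

/-- `𝒰 = 𝒥 𝒟 𝒩⁻¹ 𝒟`, of size `n`, in the case `r = 2n-1`. -/
def rothUOdd (n : ℕ) : Matrix (Fin n) (Fin n) ℝ :=
  exchangeMat n *
    (binomD (2 * n - 1) n * (binomN (2 * n - 1) n)⁻¹ * binomD (2 * n - 1) n)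

/-- `𝒰 = 𝒥 𝒟 𝒩' 𝒟`, of size `n+1`, in the case `r = 2n`. -/
def rothUEven (n : ℕ) : Matrix (Fin (n + 1)) (Fin (n + 1)) ℝ :=
  exchangeMat (n + 1) *
    (binomD (2 * n) (n + 1) * binomN' n * binomD (2 * n) (n + 1))

/-- The equation `U X - Yᵀ Uᵀ = C` has a solution in upper-triangular matrices `X`, `Y` for every
square matrix `C` of the size of `U`. -/
def RothSolvable {s : ℕ} (U : Matrix (Fin s) (Fin s) ℝ) : Prop :=
  ∀ C : Matrix (Fin s) (Fin s) ℝ, ∃ X Y : Matrix (Fin s) (Fin s) ℝ,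
    X.IsUpperTriangular ∧ Y.IsUpperTriangular ∧ U * X - Yᵀ * Uᵀ = C

end

/-! Write `f` in `K(r)`, dehomogenized at `y = 1`, as `∑ f_k(x) z^k`. The first ideal does not
involve `z`, so membership of `f y^(r+1)` splits into one condition per slice: `f_k ≡ b (1 +
x)^(r+1)` mod `x^(r+1)` for some `b` of degree at most `r - k` (`mul_pow_mem_span_iff`). The second
ideal gives the same condition with `x` and `z` exchanged.

Everything rests on a gap lemma (`eq_zero_of_coeff_mul_one_add_X_pow_eq_zero`): if `deg b < n` and
`b (1 + x)^(r+1)` has no terms in degrees `s, …, r`, then `b = 0`. It makes `𝒩` invertible, and it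
kills every slice with `k ≥ s`, so that `f` amounts to an `s × s` coefficient matrix `B`. For the
remaining slices, the vanishing of degrees `s, …, r` determines `b` from its top `s` coefficients,
and `𝒰` carries these to the low coefficients of the product, up to sign and reversal. The bound
`deg b ≤ r - k` becomes triangularity, so the two ideals say `B = 𝒰X` and `Bᵀ = 𝒰Y` with `X`, `Y`
upper triangular.

Since `𝒰` is invertible, `K(r)` is isomorphic to the kernel of `(X, Y) ↦ 𝒰X - Yᵀ𝒰ᵀ`, a map from
dimension `s² + s` to dimension `s²`. By rank-nullity the kernel has dimension `s` exactly when the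
map is onto. -/

/-! ### Ideal membership, slice by slice -/

/-- Dehomogenization `y = 1` of a polynomial in `x, y, z`, as a polynomial in `z` whose
coefficients are polynomials in `x`. -/
noncomputable def dehomog : MvPolynomial (Fin 3) ℝ →ₐ[ℝ] Polynomial (Polynomial ℝ) :=
  aeval ![Polynomial.C Polynomial.X, 1, Polynomial.X]

/-- The substitution embedding `ℝ[x,y]` into `ℝ[x,y,z]`. -/
noncomputable def embedXY : MvPolynomial (Fin 2) ℝ →ₐ[ℝ] MvPolynomial (Fin 3) ℝ :=
  aeval ![X 0, X 1]

lemma dehomog_X0 : dehomog (X 0) = Polynomial.C Polynomial.X := by simp [dehomog]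
lemma dehomog_X1 : dehomog (X 1) = 1 := by simp [dehomog]

lemma dehomog_monomial (e : Fin 3 →₀ ℕ) (c : ℝ) :
    dehomog (monomial e c) = Polynomial.monomial (e 2) (Polynomial.monomial (e 0) c) := by
  rw [dehomog, aeval_monomial, Finsupp.prod_fintype _ _ (by simp), Fin.prod_univ_three]
  simp only [cons_val_zero, cons_val_one, cons_val, one_pow, mul_one]
  rw [← Polynomial.C_mul_X_pow_eq_monomial, ← Polynomial.C_mul_X_pow_eq_monomial,
    IsScalarTower.algebraMap_apply ℝ (Polynomial ℝ) (Polynomial (Polynomial ℝ))]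
  simp [mul_assoc]

lemma coeff_dehomog_eq_zero {r : ℕ} {f : MvPolynomial (Fin 3) ℝ} (hf : f.IsHomogeneous r)
    {i k : ℕ} (h : r < i + k) : ((dehomog f).coeff k).coeff i = 0 := by
  rw [f.as_sum, map_sum, Polynomial.finsetSum_coeff, Polynomial.finsetSum_coeff]
  refine Finset.sum_eq_zero fun e he => ?_
  have hd := hf (mem_support_iff.mp he)
  rw [Finsupp.weight_apply, Finsupp.sum_fintype _ _ (by simp), Fin.sum_univ_three] at hd
  simp at hd
  rw [dehomog_monomial, Polynomial.coeff_monomial]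
  split_ifs with h2
  · rw [Polynomial.coeff_monomial, if_neg (by omega)]
  · simp

lemma natDegree_coeff_dehomog_le {r : ℕ} {f : MvPolynomial (Fin 3) ℝ} (hf : f.IsHomogeneous r)
    {k : ℕ} (hk : k ≤ r) : ((dehomog f).coeff k).natDegree ≤ r - k :=
  Polynomial.natDegree_le_iff_coeff_eq_zero.mpr fun _ hN => coeff_dehomog_eq_zero hf (by omega)

lemma embedXY_homogenize_monomial {m d : ℕ} (h : m ≤ d) (c : ℝ) :
    embedXY ((Polynomial.monomial m c).homogenize d) = C c * (X 0 ^ m * X 1 ^ (d - m)) := by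
  rw [← Polynomial.C_mul_X_pow_eq_monomial, Polynomial.homogenize_C_mul,
    Polynomial.homogenize_X_pow h]
  simp [embedXY, algebraMap_eq]

lemma eq_sum_embedXY_homogenize {r : ℕ} {f : MvPolynomial (Fin 3) ℝ} (hf : f.IsHomogeneous r) :
    f = ∑ k ∈ Finset.range (r + 1),
      X 2 ^ k * embedXY (((dehomog f).coeff k).homogenize (r - k)) := by
  have key : ∀ g : MvPolynomial (Fin 3) ℝ, (∀ e ∈ g.support, e 0 + e 1 + e 2 = r) →
      g = ∑ k ∈ Finset.range (r + 1),
        X 2 ^ k * embedXY (((dehomog g).coeff k).homogenize (r - k)) := by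
    intro g hg
    conv_lhs => rw [g.as_sum]
    conv_rhs => rw [g.as_sum]
    simp only [map_sum, Polynomial.finsetSum_coeff, Polynomial.homogenize_finsetSum,
      Finset.mul_sum]
    rw [Finset.sum_comm]
    refine Finset.sum_congr rfl fun e he => ?_
    have h := hg e he
    rw [Finset.sum_eq_single (e 2)]
    · rw [dehomog_monomial, Polynomial.coeff_monomial, if_pos rfl,
        embedXY_homogenize_monomial (by omega), monomial_eq, Finsupp.prod_fintype _ _ (by simp),
        Fin.prod_univ_three, show r - e 2 - e 0 = e 1 by omega]
      ring
    · intro k _ hk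
      rw [dehomog_monomial, Polynomial.coeff_monomial, if_neg (Ne.symm hk)]
      simp
    · intro hk
      simp at hk
      omega
  refine key f fun e he => ?_
  have hd := hf (mem_support_iff.mp he)
  rw [Finsupp.weight_apply, Finsupp.sum_fintype _ _ (by simp), Fin.sum_univ_three] at hd
  simpa using hd

lemma dehomog_injective_of_isHomogeneous {r : ℕ} {f g : MvPolynomial (Fin 3) ℝ}
    (hf : f.IsHomogeneous r) (hg : g.IsHomogeneous r) (h : dehomog f = dehomog g) : f = g := by
  rw [eq_sum_embedXY_homogenize hf, eq_sum_embedXY_homogenize hg, h]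

/-- Homogeneous witnesses for membership in an ideal generated by two forms of equal degree. -/
lemma exists_isHomogeneous_of_mem_span_pair {σ : Type*} {d m : ℕ} {p u v : MvPolynomial σ ℝ}
    (hp : p.IsHomogeneous (d + m)) (hu : u.IsHomogeneous m) (hv : v.IsHomogeneous m)
    (h : p ∈ Ideal.span {u, v}) :
    ∃ a b : MvPolynomial σ ℝ, a.IsHomogeneous d ∧ b.IsHomogeneous d ∧ a * u + b * v = p := by
  classical
  let := MvPolynomial.gradedAlgebra (σ := σ) (R := ℝ)
  obtain ⟨a, b, hab⟩ := Ideal.mem_span_pair.mp h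
  have hmul : ∀ {a u : MvPolynomial σ ℝ}, u.IsHomogeneous m →
      homogeneousComponent (d + m) (a * u) = homogeneousComponent d a * u := by
    intro a u hu
    have := DirectSum.coe_decompose_mul_of_right_mem_of_le (homogeneousSubmodule σ ℝ) (a := a)
      (b := u) (n := d + m) (i := m) hu (by omega)
    rw [Nat.add_sub_cancel] at this
    simpa [← decomposition.decompose'_apply] using this
  refine ⟨homogeneousComponent d a, homogeneousComponent d b,
    homogeneousComponent_isHomogeneous _ _, homogeneousComponent_isHomogeneous _ _, ?_⟩
  rw [← hmul hu, ← hmul hv, ← map_add, hab]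
  exact homogeneousComponent_eq_self hp

lemma natDegree_one_add_X_pow_le (m : ℕ) :
    ((1 + Polynomial.X : Polynomial ℝ) ^ m).natDegree ≤ m := by
  compute_degree!

lemma homogenize_one_add_X_pow (m : ℕ) :
    embedXY (((1 + Polynomial.X : Polynomial ℝ) ^ m).homogenize m) = (X 0 + X 1) ^ m := by
  induction m with
  | zero => simp
  | succ m ih =>
    rw [pow_succ, Polynomial.homogenize_mul _ _ (natDegree_one_add_X_pow_le m)
      (by compute_degree!), map_mul, ih, pow_succ]
    simp [embedXY, add_comm]

/-- Setting `y = 1` hides the factor `y^(r+1)`, and the generators are free of `z`, so coefficients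
of `z^k` can be compared separately. The degree bound on `b` is what homogeneity leaves behind; it
permits rehomogenizing for the converse. -/
lemma mul_pow_mem_span_iff {r : ℕ} {f : MvPolynomial (Fin 3) ℝ} (hf : f.IsHomogeneous r) :
    f * X 1 ^ (r + 1) ∈
        Ideal.span {X 0 ^ (r + 1), ((X 0 + X 1) ^ (r + 1) : MvPolynomial (Fin 3) ℝ)} ↔
      ∀ k ≤ r, ∃ b : Polynomial ℝ, b.natDegree ≤ r - k ∧
        Polynomial.X ^ (r + 1) ∣
          b * (1 + Polynomial.X) ^ (r + 1) - (dehomog f).coeff k := by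
  constructor
  · intro h k hk
    obtain ⟨a, b, -, hb, hab⟩ := exists_isHomogeneous_of_mem_span_pair (d := r)
      (hf.mul (isHomogeneous_X_pow 1 (r + 1))) (isHomogeneous_X_pow 0 (r + 1))
      (by simpa using ((isHomogeneous_X ℝ (0 : Fin 3)).add (isHomogeneous_X ℝ 1)).pow (r + 1)) h
    refine ⟨(dehomog b).coeff k, natDegree_coeff_dehomog_le hb hk, -(dehomog a).coeff k, ?_⟩
    have h1 := congrArg (fun p => (dehomog p).coeff k) hab
    simp only [map_add, map_mul, map_pow, dehomog_X0, dehomog_X1, one_pow, mul_one,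
      Polynomial.coeff_add] at h1
    rw [show (Polynomial.C Polynomial.X + 1 : Polynomial (Polynomial ℝ)) =
      Polynomial.C (1 + Polynomial.X) by simp [add_comm], ← Polynomial.C_pow, ← Polynomial.C_pow,
      Polynomial.coeff_mul_C, Polynomial.coeff_mul_C] at h1
    rw [← h1]
    ring
  · intro h
    rw [eq_sum_embedXY_homogenize hf, Finset.sum_mul]
    refine Ideal.sum_mem _ fun k hk => ?_
    have hk : k ≤ r := by simp at hk; omega
    obtain ⟨b, hb, c, hc⟩ := h k hk
    rw [mul_assoc]
    refine Ideal.mul_mem_left _ _ ?_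
    have hg := natDegree_coeff_dehomog_le hf hk
    -- The cofactor of `X^(r+1)` must satisfy the same bound as `b`, so that both products
    -- rehomogenize in the common degree `r - k + (r + 1)`.
    have hcd : c.natDegree ≤ r - k := by
      by_cases hc0 : c = 0
      · simp [hc0]
      have h1 : (Polynomial.X ^ (r + 1) * c).natDegree ≤ r - k + (r + 1) := by
        rw [← hc]
        refine (Polynomial.natDegree_sub_le _ _).trans (max_le ?_ (by omega))
        exact Polynomial.natDegree_mul_le.trans
          (add_le_add hb (natDegree_one_add_X_pow_le (r + 1)))
      rw [Polynomial.natDegree_X_pow_mul _ hc0] at h1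
      omega
    have h2 : b * (1 + Polynomial.X) ^ (r + 1) =
        (dehomog f).coeff k * 1 + c * Polynomial.X ^ (r + 1) := by
      linear_combination hc
    have h3 := congrArg (fun p => embedXY (p.homogenize (r - k + (r + 1)))) h2
    simp only [Polynomial.homogenize_add] at h3
    rw [Polynomial.homogenize_mul _ _ hb (natDegree_one_add_X_pow_le (r + 1)),
      Polynomial.homogenize_mul _ _ hg (by simp),
      Polynomial.homogenize_mul _ _ hcd (by simp), map_add, map_mul, map_mul, map_mul,
      homogenize_one_add_X_pow, Polynomial.homogenize_one,
      Polynomial.homogenize_X_pow le_rfl] at h3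
    simp only [embedXY, map_pow, aeval_X, cons_val_zero, cons_val_one, Nat.sub_self,
      pow_zero, mul_one] at h3
    refine Ideal.mem_span_pair.mpr ⟨-embedXY (c.homogenize (r - k)),
      embedXY (b.homogenize (r - k)), ?_⟩
    simp only [embedXY]
    linear_combination h3

lemma dehomog_rename_swap (f : MvPolynomial (Fin 3) ℝ) :
    dehomog (rename (Equiv.swap 0 2) f) = Polynomial.Bivariate.swap (dehomog f) := by
  have : dehomog.comp (rename (Equiv.swap (0 : Fin 3) 2)) =
      (Polynomial.Bivariate.swap : _ ≃ₐ[ℝ] _).toAlgHom.comp dehomog := by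
    refine algHom_ext fun i => ?_
    fin_cases i
    · have : (Equiv.swap (0 : Fin 3) 2) 0 = 2 := by decide
      simpa [dehomog, this] using Polynomial.Bivariate.swap_X.symm
    · have : (Equiv.swap (0 : Fin 3) 2) 1 = 1 := by decide
      simp [dehomog, this]
    · have : (Equiv.swap (0 : Fin 3) 2) 2 = 0 := by decide
      simpa [dehomog, this] using Polynomial.Bivariate.swap_Y.symm
  exact DFunLike.congr_fun this f

lemma coeff_coeff_bivariate_swap (p : Polynomial (Polynomial ℝ)) (i k : ℕ) :
    ((Polynomial.Bivariate.swap p).coeff k).coeff i = (p.coeff i).coeff k := by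
  induction p using Polynomial.induction_on' with
  | add p q hp hq => simp only [map_add, Polynomial.coeff_add, hp, hq]
  | monomial m q =>
    induction q using Polynomial.induction_on' with
    | add p q hp hq => simp only [map_add, Polynomial.coeff_add, hp, hq]
    | monomial l c =>
      rw [Polynomial.Bivariate.swap_monomial_monomial]
      simp only [Polynomial.coeff_monomial]
      split_ifs <;> simp_all [Polynomial.coeff_monomial]

lemma mem_span_z_iff (r : ℕ) (f : MvPolynomial (Fin 3) ℝ) :
    f * X 1 ^ (r + 1) ∈
        Ideal.span {X 2 ^ (r + 1), ((X 2 + X 1) ^ (r + 1) : MvPolynomial (Fin 3) ℝ)} ↔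
      rename (Equiv.swap 0 2) f * X 1 ^ (r + 1) ∈
        Ideal.span {X 0 ^ (r + 1), ((X 0 + X 1) ^ (r + 1) : MvPolynomial (Fin 3) ℝ)} := by
  have h0 : (Equiv.swap (0 : Fin 3) 2) 0 = 2 := by decide
  have h1 : (Equiv.swap (0 : Fin 3) 2) 1 = 1 := by decide
  have h2 : (Equiv.swap (0 : Fin 3) 2) 2 = 0 := by decide
  have hs : ∀ p : MvPolynomial (Fin 3) ℝ,
      rename (Equiv.swap (0 : Fin 3) 2) (rename (Equiv.swap (0 : Fin 3) 2) p) = p := by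
    intro p
    have : ⇑(Equiv.swap (0 : Fin 3) 2) ∘ ⇑(Equiv.swap (0 : Fin 3) 2) = id := by
      funext i
      simp
    rw [rename_rename, this, rename_id_apply]
  rw [Ideal.mem_span_pair, Ideal.mem_span_pair]
  constructor
  · rintro ⟨a, b, h⟩
    refine ⟨rename (Equiv.swap 0 2) a, rename (Equiv.swap 0 2) b, ?_⟩
    have := congrArg (rename (Equiv.swap (0 : Fin 3) 2)) h
    simpa [h0, h1, h2] using this
  · rintro ⟨a, b, h⟩
    refine ⟨rename (Equiv.swap 0 2) a, rename (Equiv.swap 0 2) b, ?_⟩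
    have := congrArg (rename (Equiv.swap (0 : Fin 3) 2)) h
    simpa [h0, h1, h2, hs, -rename_rename] using this

lemma mem_splineK_iff {r : ℕ} {f : MvPolynomial (Fin 3) ℝ} :
    f ∈ splineK r ↔ f.IsHomogeneous r ∧
      (∀ k ≤ r, ∃ b : Polynomial ℝ, b.natDegree ≤ r - k ∧
        Polynomial.X ^ (r + 1) ∣
          b * (1 + Polynomial.X) ^ (r + 1) - (dehomog f).coeff k) ∧
      ∀ k ≤ r, ∃ b : Polynomial ℝ, b.natDegree ≤ r - k ∧
        Polynomial.X ^ (r + 1) ∣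
          b * (1 + Polynomial.X) ^ (r + 1) - (Polynomial.Bivariate.swap (dehomog f)).coeff k := by
  rw [splineK, Submodule.mem_inf, mem_homogeneousSubmodule, Submodule.restrictScalars_mem,
    Submodule.mem_colon_singleton, smul_eq_mul, Submodule.mem_inf, mem_span_z_iff]
  refine and_congr_right fun hf => ?_
  rw [mul_pow_mem_span_iff hf, mul_pow_mem_span_iff hf.rename_isHomogeneous, dehomog_rename_swap]

/-! ### The gap lemma and invertibility of `𝒩` -/

/-- A polynomial multiple `b (1 + X)^(r+1)` with `deg b < n` has no gap of length `n` ending in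
degree `r`, unless it is zero. -/
lemma eq_zero_of_coeff_mul_one_add_X_pow_eq_zero {n s r : ℕ} (hr : r + 1 = n + s)
    {b : Polynomial ℝ} (hb : b.degree < n)
    (h : ∀ i, s ≤ i → i ≤ r → (b * (1 + Polynomial.X) ^ (r + 1)).coeff i = 0) : b = 0 := by
  by_contra hb0
  have hnd : b.natDegree < n := (Polynomial.natDegree_lt_iff_degree_lt hb0).mpr hb
  set p := b * (1 + Polynomial.X) ^ (r + 1) with hp
  have hpd : p.natDegree ≤ b.natDegree + (r + 1) :=
    Polynomial.natDegree_mul_le.trans (add_le_add le_rfl (natDegree_one_add_X_pow_le _))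
  -- The `s`-th derivative keeps `(r + 1) - s = n` factors `1 + X` and moves the gap to degrees `0,
  -- …, n - 1`. So `X^n (1 + X)^n` divides `D`, whose degree is below `2n`.
  set D := Polynomial.derivative^[s] p with hD
  have h1 : (1 + Polynomial.X : Polynomial ℝ) ^ n ∣ D := by
    have := Polynomial.pow_sub_dvd_iterate_derivative_of_pow_dvd (p := p)
      (q := (1 + Polynomial.X : Polynomial ℝ)) (n := r + 1) s (Dvd.intro_left _ rfl)
    rwa [hr, Nat.add_sub_cancel] at this
  have h2 : (Polynomial.X : Polynomial ℝ) ^ n ∣ D := by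
    rw [Polynomial.X_pow_dvd_iff]
    intro d hd
    rw [hD, Polynomial.coeff_iterate_derivative, h _ (by omega) (by omega), smul_zero]
  have hc : IsCoprime ((Polynomial.X : Polynomial ℝ) ^ n) ((1 + Polynomial.X) ^ n) :=
    IsCoprime.pow ⟨-1, 1, by ring⟩
  have hDd : D.natDegree < 2 * n := by
    have := Polynomial.natDegree_iterate_derivative p s
    rw [← hD] at this
    omega
  have hD0 : D = 0 := by
    by_contra hne
    have := Polynomial.natDegree_le_of_dvd (hc.mul_dvd h2 h1) hne
    have hm : ((1 + Polynomial.X : Polynomial ℝ)).Monic := by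
      rw [add_comm]
      exact Polynomial.monic_X_add_C 1
    rw [Polynomial.natDegree_X_pow_mul _ (pow_ne_zero _ hm.ne_zero), hm.natDegree_pow,
      add_comm 1, show (1 : Polynomial ℝ) = Polynomial.C 1 from rfl,
      Polynomial.natDegree_X_add_C] at this
    omega
  -- In characteristic zero, a vanishing `s`-th derivative forces degree below `s`, whereas `p` has
  -- degree `deg b + r + 1`.
  have hlead : p.natDegree < s := by
    by_contra hge
    push Not at hge
    have := congrArg (fun q => q.coeff (p.natDegree - s)) hD0
    simp only [hD, Polynomial.coeff_iterate_derivative, Polynomial.coeff_zero] at this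
    rw [Nat.sub_add_cancel hge] at this
    have hpos : (p.natDegree).descFactorial s ≠ 0 := by
      rw [Ne, Nat.descFactorial_eq_zero_iff_lt]
      omega
    have hp0 : p ≠ 0 := mul_ne_zero hb0 (pow_ne_zero _ (by
      rw [add_comm]; exact (Polynomial.monic_X_add_C (1 : ℝ)).ne_zero))
    simp [hpos, hp0] at this
  have : p.natDegree = b.natDegree + (r + 1) := by
    have hm : ((1 + Polynomial.X : Polynomial ℝ)).Monic := by
      rw [add_comm]
      exact Polynomial.monic_X_add_C 1
    rw [hp, Polynomial.natDegree_mul' (by simp [hb0, (hm.pow (r+1)).leadingCoeff]),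
      hm.natDegree_pow, add_comm 1, show (1 : Polynomial ℝ) = Polynomial.C 1 from rfl,
      Polynomial.natDegree_X_add_C, mul_one]
  omega

lemma coeff_mul_one_add_X_pow (b : Polynomial ℝ) (m i : ℕ) :
    (b * (1 + Polynomial.X) ^ m).coeff i =
      ∑ j ∈ Finset.range (i + 1), b.coeff j * (m.choose (i - j) : ℝ) := by
  rw [Polynomial.coeff_mul,
    Finset.Nat.sum_antidiagonal_eq_sum_range_succ_mk]
  simp [Polynomial.coeff_one_add_X_pow]

lemma binomD_mulVec {s : ℕ} (r : ℕ) (c : ℕ → ℝ) (i : Fin s) :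
    (binomD r s *ᵥ fun j => c j) i =
      ∑ j ∈ Finset.range ((i : ℕ) + 1), c j * ((r + 1).choose (i - j) : ℝ) := by
  have h1 : (binomD r s *ᵥ fun j => c j) i = ∑ j : Fin s,
      (fun j : ℕ => if j ≤ i then c j * ((r + 1).choose (i - j) : ℝ) else 0) j := by
    simp only [mulVec, dotProduct, binomD, of_apply, Fin.le_def]
    refine Finset.sum_congr rfl fun j _ => ?_
    split_ifs <;> ring
  rw [h1, Fin.sum_univ_eq_sum_range
    (fun j : ℕ => if j ≤ i then c j * ((r + 1).choose (i - j) : ℝ) else 0)]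
  rw [← Finset.sum_filter]
  refine Finset.sum_congr ?_ fun _ _ => rfl
  ext j
  simp only [Finset.mem_filter, Finset.mem_range]
  omega

lemma binomN_mulVec {r n s : ℕ} (hr : r + 1 = n + s) (c : ℕ → ℝ) (i : Fin n) :
    (binomN r n *ᵥ fun j => c j) i =
      ∑ j ∈ Finset.range n, c j * ((r + 1).choose (s + i - j) : ℝ) := by
  rw [← Fin.sum_univ_eq_sum_range (fun j => c j * ((r + 1).choose (s + i - j) : ℝ))]
  simp only [mulVec, dotProduct, binomN, of_apply, show r + 1 - n = s by omega]
  exact Finset.sum_congr rfl fun j _ => mul_comm _ _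

lemma ofFn_coeff {n : ℕ} (v : Fin n → ℝ) (j : Fin n) :
    (Polynomial.ofFn n v).coeff j = v j :=
  Polynomial.ofFn_coeff_eq_val_of_lt v j.2

/-- A kernel vector lists the coefficients of some `b` of degree below `n`, and the entries of its
image are the coefficients of `b (1 + X)^(r+1)` in degrees `s, …, r`. The gap lemma applies. -/
lemma isUnit_binomN {r n s : ℕ} (hr : r + 1 = n + s) (hns : n ≤ s) : IsUnit (binomN r n) := by
  rw [← mulVec_injective_iff_isUnit]
  refine (injective_iff_map_eq_zero (binomN r n).mulVecLin).mpr fun v hv => ?_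
  set b := Polynomial.ofFn n v with hb
  have hbv : v = fun j : Fin n => b.coeff j := funext fun j => (ofFn_coeff v j).symm
  have hb0 : b = 0 := by
    refine eq_zero_of_coeff_mul_one_add_X_pow_eq_zero hr (Polynomial.ofFn_degree_lt v) ?_
    intro i h1 h2
    have := congrFun hv ⟨i - s, by omega⟩
    rw [mulVecLin_apply, hbv, binomN_mulVec hr] at this
    simp only [Pi.zero_apply, Nat.add_sub_cancel' h1] at this
    rw [coeff_mul_one_add_X_pow, ← this]
    refine (Finset.sum_subset (fun j hj => ?_) fun j _ hj => ?_).symm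
    · simp at hj ⊢
      omega
    · rw [Polynomial.ofFn_coeff_eq_zero_of_ge v (by simpa using hj), zero_mul]
  rw [hbv, hb0]
  rfl

/-! ### The meaning of `𝒰` -/

/-- `U` sends the top coefficients of a polynomial `b` of degree at most `r` to the (negated,
reversed) low coefficients of `b (1 + X)^(r+1)`, under the condition that the coefficients of
degree `s, …, r` of the latter vanish. -/
def RepresentsLowCoeff (r n : ℕ) {s : ℕ} (U : Matrix (Fin s) (Fin s) ℝ) : Prop :=
  ∀ g h : Fin s → ℝ, U *ᵥ h = g ↔ ∃ b : Polynomial ℝ, b.natDegree ≤ r ∧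
    (∀ u : Fin s, b.coeff (n + u) = h u) ∧
    (∀ i : Fin s, (b * (1 + Polynomial.X) ^ (r + 1)).coeff i = -g (Fin.rev i)) ∧
    ∀ i, s ≤ i → i ≤ r → (b * (1 + Polynomial.X) ^ (r + 1)).coeff i = 0

/-- Any top coefficients can be completed so that the middle coefficients of
`b (1 + X)^(r+1)` vanish. -/
lemma exists_coeff_eq_of_binomN {r n s : ℕ} (hr : r + 1 = n + s) (hns : n ≤ s)
    (h : Fin s → ℝ) : ∃ b : Polynomial ℝ, b.natDegree ≤ r ∧
      (∀ u : Fin s, b.coeff (n + u) = h u) ∧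
      ∀ i, s ≤ i → i ≤ r → (b * (1 + Polynomial.X) ^ (r + 1)).coeff i = 0 := by
  set H := Polynomial.X ^ n * Polynomial.ofFn s h with hH
  -- Invertibility of `𝒩` supplies a part of degree below `n` that cancels the contribution of `H`
  -- in degrees `s, …, r`.
  obtain ⟨v, hv⟩ := (mulVec_surjective_iff_isUnit.mpr (isUnit_binomN hr hns))
    (fun i : Fin n => -(H * (1 + Polynomial.X) ^ (r + 1)).coeff (s + i))
  set V := Polynomial.ofFn n v with hV
  have hVd : V.degree < n := Polynomial.ofFn_degree_lt v
  refine ⟨V + H, ?_, fun u => ?_, fun i h1 h2 => ?_⟩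
  · rw [Polynomial.natDegree_le_iff_coeff_eq_zero]
    intro N hN
    rw [Polynomial.coeff_add, Polynomial.ofFn_coeff_eq_zero_of_ge v (by omega), hH,
      Polynomial.coeff_X_pow_mul', if_pos (by omega),
      Polynomial.ofFn_coeff_eq_zero_of_ge h (by omega), add_zero]
  · rw [Polynomial.coeff_add, Polynomial.ofFn_coeff_eq_zero_of_ge v (by omega), hH,
      add_comm n, Polynomial.coeff_X_pow_mul, ofFn_coeff, zero_add]
  · have := congrFun hv ⟨i - s, by omega⟩
    rw [show v = fun j : Fin n => V.coeff j from funext fun j => (ofFn_coeff v j).symm,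
      binomN_mulVec hr] at this
    simp only [Nat.add_sub_cancel' h1] at this
    rw [add_mul, Polynomial.coeff_add, ← neg_eq_iff_add_eq_zero.mp this.symm, add_comm]
    congr 1
    rw [coeff_mul_one_add_X_pow]
    refine (Finset.sum_subset (fun j hj => ?_) fun j _ hj => ?_).symm
    · simp at hj ⊢
      omega
    · rw [Polynomial.ofFn_coeff_eq_zero_of_ge v (by simpa using hj), zero_mul]

lemma exchangeMat_mulVec {s : ℕ} (v : Fin s → ℝ) (i : Fin s) :
    (exchangeMat s *ᵥ v) i = v (Fin.rev i) := by
  simp [mulVec, dotProduct, exchangeMat]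

/-- The right-hand `𝒟` and `M` recover, up to sign, the low `s` coefficients of `b` from its top
ones; the left-hand `𝒟` multiplies by `(1 + X)^(r+1)` below degree `s`; `𝒥` reverses the order. -/
lemma representsLowCoeff_of_gap {r n s : ℕ} (hr : r + 1 = n + s) (hns : n ≤ s)
    (M : Matrix (Fin s) (Fin s) ℝ)
    (hM : ∀ b : Polynomial ℝ,
      (∀ i, s ≤ i → i ≤ r → (b * (1 + Polynomial.X) ^ (r + 1)).coeff i = 0) →
      (fun j : Fin s => b.coeff j) = -(M *ᵥ (binomD r s *ᵥ fun u => b.coeff (n + u)))) :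
    RepresentsLowCoeff r n (exchangeMat s * (binomD r s * M * binomD r s)) := by
  have key : ∀ b : Polynomial ℝ,
      (∀ i, s ≤ i → i ≤ r → (b * (1 + Polynomial.X) ^ (r + 1)).coeff i = 0) →
      ∀ i : Fin s, (b * (1 + Polynomial.X) ^ (r + 1)).coeff i =
        -((exchangeMat s * (binomD r s * M * binomD r s)) *ᵥ fun u => b.coeff (n + u))
          (Fin.rev i) := by
    intro b hb i
    rw [← mulVec_mulVec, exchangeMat_mulVec, Fin.rev_rev, Matrix.mul_assoc, ← mulVec_mulVec,
      ← mulVec_mulVec, ← Pi.neg_apply, ← mulVec_neg, ← hM b hb, binomD_mulVec,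
      coeff_mul_one_add_X_pow]
  intro g h
  constructor
  · rintro rfl
    obtain ⟨b, hb, hbh, hgap⟩ := exists_coeff_eq_of_binomN hr hns h
    refine ⟨b, hb, hbh, fun i => ?_, hgap⟩
    rw [key b hgap, funext hbh]
  · rintro ⟨b, hb, hbh, hg, hgap⟩
    rw [← funext hbh]
    funext i
    have h1 := key b hgap (Fin.rev i)
    rw [hg, Fin.rev_rev] at h1
    exact (neg_injective h1).symm

lemma sum_range_add_choose (b : Polynomial ℝ) (m n i : ℕ) :
    (b * (1 + Polynomial.X) ^ m).coeff (n + i) =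
      ∑ j ∈ Finset.range n, b.coeff j * (m.choose (n + i - j) : ℝ) +
      ∑ u ∈ Finset.range (i + 1), b.coeff (n + u) * (m.choose (i - u) : ℝ) := by
  rw [coeff_mul_one_add_X_pow, Nat.add_assoc, Finset.sum_range_add]
  simp only [Nat.add_sub_add_left]

/-- Here the gap condition reads `𝒩 b_low + 𝒟 b_top = 0`, split at degree `n = s`. -/
lemma representsLowCoeff_rothUOdd {n : ℕ} (hn : 1 ≤ n) :
    RepresentsLowCoeff (2 * n - 1) n (rothUOdd n) := by
  have hr : 2 * n - 1 + 1 = n + n := by omega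
  refine representsLowCoeff_of_gap hr le_rfl _ fun b hb => ?_
  have hN := isUnit_binomN hr le_rfl
  have h1 : (binomN (2 * n - 1) n *ᵥ fun j => b.coeff j) =
      -(binomD (2 * n - 1) n *ᵥ fun u => b.coeff (n + u)) := by
    funext i
    have := hb (n + i) (by omega) (by omega)
    rw [sum_range_add_choose] at this
    rw [binomN_mulVec hr, Pi.neg_apply, binomD_mulVec (2 * n - 1) (fun u => b.coeff (n + u))]
    linarith
  rw [← mulVec_neg, ← h1, mulVec_mulVec,
    nonsing_inv_mul _ ((isUnit_iff_isUnit_det _).mp hN), one_mulVec]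

lemma binomN'_mulVec_last (n : ℕ) (v : Fin (n + 1) → ℝ) :
    (binomN' n *ᵥ v) (Fin.last n) = -v 0 := by
  simp [mulVec, dotProduct, binomN', Fin.sum_univ_succ]

lemma binomN'_mulVec_castSucc (n : ℕ) (v : Fin (n + 1) → ℝ) (i : Fin n) :
    (binomN' n *ᵥ v) i.castSucc = ((binomN (2 * n) n)⁻¹ *ᵥ fun j => v j.succ) i := by
  simp [mulVec, dotProduct, binomN', Fin.sum_univ_succ]

/-- Now `s = n + 1`, so the low and top blocks share the coefficient of degree `n`. The gap starts
at `n + 1` and uses all entries of `𝒟 b_top` but the first; that first entry is the shared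
coefficient itself, which the `-1` in `binomN'` returns. -/
lemma representsLowCoeff_rothUEven (n : ℕ) :
    RepresentsLowCoeff (2 * n) n (rothUEven n) := by
  have hr : 2 * n + 1 = n + (n + 1) := by omega
  refine representsLowCoeff_of_gap hr (Nat.le_succ n) _ fun b hb => ?_
  have hN := isUnit_binomN hr (Nat.le_succ n)
  have h1 : (binomN (2 * n) n *ᵥ fun j => b.coeff j) =
      -fun j : Fin n => (binomD (2 * n) (n + 1) *ᵥ fun u => b.coeff (n + u)) j.succ := by
    funext i
    have := hb (n + (i + 1)) (by omega) (by omega)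
    rw [sum_range_add_choose] at this
    rw [binomN_mulVec hr, Pi.neg_apply, binomD_mulVec (2 * n) (fun u => b.coeff (n + u)),
      Fin.val_succ]
    simp only [show n + 1 + (i : ℕ) = n + (i + 1) by omega]
    linarith
  funext j
  refine Fin.lastCases ?_ (fun i => ?_) j
  · rw [Pi.neg_apply, binomN'_mulVec_last, binomD_mulVec (2 * n) (fun u => b.coeff (n + u))]
    simp
  · rw [Pi.neg_apply, binomN'_mulVec_castSucc, ← Pi.neg_apply, ← mulVec_neg, ← h1, mulVec_mulVec,
      nonsing_inv_mul _ ((isUnit_iff_isUnit_det _).mp hN), one_mulVec, Fin.val_castSucc]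

/-- A kernel vector yields `b` of degree at most `r` with `X^(r+1)` dividing `b (1 + X)^(r+1)`. By
coprimality `X^(r+1)` divides `b`, so `b = 0`. -/
lemma isUnit_of_representsLowCoeff {r n s : ℕ} {U : Matrix (Fin s) (Fin s) ℝ}
    (hU : RepresentsLowCoeff r n U) : IsUnit U := by
  rw [← mulVec_injective_iff_isUnit]
  refine (injective_iff_map_eq_zero U.mulVecLin).mpr fun h hh => ?_
  obtain ⟨b, hb, hbh, hlow, hgap⟩ := (hU 0 h).mp hh
  have hdvd : (Polynomial.X : Polynomial ℝ) ^ (r + 1) ∣ b * (1 + Polynomial.X) ^ (r + 1) := by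
    rw [Polynomial.X_pow_dvd_iff]
    intro i hi
    by_cases his : i < s
    · simpa using hlow ⟨i, his⟩
    · exact hgap i (by omega) (by omega)
  have hc : IsCoprime ((Polynomial.X : Polynomial ℝ) ^ (r + 1)) ((1 + Polynomial.X) ^ (r + 1)) :=
    IsCoprime.pow ⟨-1, 1, by ring⟩
  have hb0 : b = 0 := by
    by_contra hne
    have := Polynomial.natDegree_le_of_dvd (hc.dvd_of_dvd_mul_right hdvd) hne
    rw [Polynomial.natDegree_X_pow] at this
    omega
  funext u
  rw [← hbh u, hb0]
  rfl

/-! ### Forms in `K(r)` as matrices -/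

/-- The reversed and negated `s × s` matrix of low coefficients of a bivariate polynomial. -/
noncomputable def coeffMat (s : ℕ) (P : Polynomial (Polynomial ℝ)) : Matrix (Fin s) (Fin s) ℝ :=
  Matrix.of fun i k => -(P.coeff (Fin.rev k)).coeff (Fin.rev i)

lemma coeffMat_swap (s : ℕ) (P : Polynomial (Polynomial ℝ)) :
    coeffMat s (Polynomial.Bivariate.swap P) = (coeffMat s P)ᵀ := by
  ext i k
  simp [coeffMat, coeff_coeff_bivariate_swap]

lemma X_pow_dvd_sub_iff {r : ℕ} {p q : Polynomial ℝ} :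
    Polynomial.X ^ (r + 1) ∣ p - q ↔ ∀ i ≤ r, p.coeff i = q.coeff i := by
  simp only [Polynomial.X_pow_dvd_iff, Polynomial.coeff_sub, sub_eq_zero, Nat.lt_succ_iff]

/-- For `k ≥ s` the multiplier `b` has degree at most `r - k < n`, and the slice has no terms in
degrees `s, …, r` because `2s > r`. The gap lemma gives `b = 0`. -/
lemma coeff_eq_zero_of_forall_exists_dvd {r n s : ℕ} (hr : r + 1 = n + s) (hns : n ≤ s)
    {P : Polynomial (Polynomial ℝ)} (hP : ∀ i k, r < i + k → (P.coeff k).coeff i = 0)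
    (h : ∀ k ≤ r, ∃ b : Polynomial ℝ, b.natDegree ≤ r - k ∧
        Polynomial.X ^ (r + 1) ∣ b * (1 + Polynomial.X) ^ (r + 1) - P.coeff k)
    {i k : ℕ} (hk : s ≤ k) : (P.coeff k).coeff i = 0 := by
  by_cases hik : r < i + k
  · exact hP i k hik
  obtain ⟨b, hb, hbc⟩ := h k (by omega)
  rw [X_pow_dvd_sub_iff] at hbc
  have hb0 : b = 0 := by
    refine eq_zero_of_coeff_mul_one_add_X_pow_eq_zero hr ?_ fun j h1 h2 => ?_
    · exact (Polynomial.degree_le_of_natDegree_le hb).trans_lt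
        (by exact_mod_cast (show r - k < n by omega))
    · rw [hbc j h2, hP j k (by omega)]
  rw [← hbc i (by omega), hb0, zero_mul, Polynomial.coeff_zero]

/-- The ideal membership conditions on all slices of a bivariate polynomial, in matrix form. -/
lemma forall_exists_dvd_iff {r n s : ℕ} (hr : r + 1 = n + s)
    {U : Matrix (Fin s) (Fin s) ℝ} (hU : RepresentsLowCoeff r n U)
    {P : Polynomial (Polynomial ℝ)} (hP : ∀ i k, s ≤ i ∨ s ≤ k → (P.coeff k).coeff i = 0) :
    (∀ k ≤ r, ∃ b : Polynomial ℝ, b.natDegree ≤ r - k ∧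
        Polynomial.X ^ (r + 1) ∣ b * (1 + Polynomial.X) ^ (r + 1) - P.coeff k) ↔
      ∃ X : Matrix (Fin s) (Fin s) ℝ, X.IsUpperTriangular ∧ U * X = coeffMat s P := by
  simp only [X_pow_dvd_sub_iff]
  constructor
  · intro h
    have h2 : ∀ k : Fin s, ∃ v : Fin s → ℝ, (∀ u, k < u → v u = 0) ∧
        U *ᵥ v = fun i => coeffMat s P i k := by
      intro k
      have hrk := Fin.val_rev k
      obtain ⟨b, hb, hbc⟩ := h (Fin.rev k : Fin s) (by omega)
      refine ⟨fun u => b.coeff (n + u), fun u hu => ?_,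
        (hU _ _).mpr ⟨b, hb.trans (Nat.sub_le _ _), fun _ => rfl, fun i => ?_,
          fun i h1 h2 => ?_⟩⟩
      -- The slice index is `s - 1 - k`, so `deg b ≤ r - (s - 1 - k) = n + k`: exactly the vanishing
      -- of column `k` below the diagonal.
      · have : (k : ℕ) < u := hu
        exact Polynomial.coeff_eq_zero_of_natDegree_lt (by omega)
      · rw [hbc i (by omega), coeffMat, of_apply, neg_neg, Fin.rev_rev]
      · rw [hbc i h2, hP i _ (Or.inl h1)]
    choose v hv hUv using h2
    refine ⟨Matrix.of fun u k => v k u, fun u k hku => hv k u hku, ?_⟩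
    ext i k
    exact congrFun (hUv k) i
  · rintro ⟨X, hX, hUX⟩ k hk
    by_cases hks : k < s
    · obtain ⟨b, hb, hbh, hlow, hgap⟩ :=
        (hU (fun i => coeffMat s P i (Fin.rev ⟨k, hks⟩)) (fun u => X u (Fin.rev ⟨k, hks⟩))).mp
          (by
            rw [← hUX]
            rfl)
      refine ⟨b, ?_, fun i hi => ?_⟩
      · rw [Polynomial.natDegree_le_iff_coeff_eq_zero]
        intro N hN
        by_cases hNr : r < N
        · exact Polynomial.coeff_eq_zero_of_natDegree_lt (by omega)
        have := hbh ⟨N - n, by omega⟩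
        rw [Fin.val_mk, Nat.add_sub_cancel' (by omega)] at this
        rw [this]
        refine hX (Fin.lt_def.mpr ?_)
        simp only [id, Fin.val_rev]
        omega
      · by_cases his : i < s
        · rw [hlow ⟨i, his⟩, coeffMat, of_apply, neg_neg, Fin.rev_rev, Fin.rev_rev]
        · rw [hgap i (by omega) hi, hP i k (Or.inl (by omega))]
    · refine ⟨0, by simp, fun i hi => ?_⟩
      rw [hP i k (Or.inr (by omega)), zero_mul, Polynomial.coeff_zero]

/-- The form of degree `r` whose reversed and negated coefficient matrix is `B`. -/
noncomputable def formOfMat (r s : ℕ) :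
    Matrix (Fin s) (Fin s) ℝ →ₗ[ℝ] MvPolynomial (Fin 3) ℝ :=
  ∑ i : Fin s, ∑ k : Fin s,
    (monomial (Finsupp.equivFunOnFinite.symm ![(i : ℕ), r - i - k, (k : ℕ)])).comp
      (-Matrix.entryLinearMap ℝ ℝ (Fin.rev i) (Fin.rev k))

lemma formOfMat_apply (r s : ℕ) (B : Matrix (Fin s) (Fin s) ℝ) :
    formOfMat r s B = ∑ i : Fin s, ∑ k : Fin s,
      monomial (Finsupp.equivFunOnFinite.symm ![(i : ℕ), r - i - k, (k : ℕ)])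
        (-B (Fin.rev i) (Fin.rev k)) := by
  simp [formOfMat]

/-- The hypothesis gives `i + k ≤ 2(s - 1) ≤ r`, so the exponent `r - i - k` of `y` is not
truncated. -/
lemma isHomogeneous_formOfMat {r s : ℕ} (h : 2 * s ≤ r + 2) (B : Matrix (Fin s) (Fin s) ℝ) :
    (formOfMat r s B).IsHomogeneous r := by
  rw [formOfMat_apply]
  refine IsHomogeneous.sum _ _ _ fun i _ => IsHomogeneous.sum _ _ _ fun k _ =>
    isHomogeneous_monomial _ ?_
  rw [Finsupp.degree_eq_sum, Fin.sum_univ_three]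
  simp
  omega

lemma coeff_dehomog_formOfMat (r s : ℕ) (B : Matrix (Fin s) (Fin s) ℝ) (i k : ℕ) :
    ((dehomog (formOfMat r s B)).coeff k).coeff i =
      if h : i < s ∧ k < s then -B (Fin.rev ⟨i, h.1⟩) (Fin.rev ⟨k, h.2⟩) else 0 := by
  have h1 : ((dehomog (formOfMat r s B)).coeff k).coeff i =
      ∑ i' : Fin s, ∑ k' : Fin s, if (k' : ℕ) = k then
        (if (i' : ℕ) = i then -B (Fin.rev i') (Fin.rev k') else 0) else 0 := by
    simp only [formOfMat_apply, map_sum, Polynomial.finsetSum_coeff, dehomog_monomial,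
      Polynomial.coeff_monomial]
    refine Finset.sum_congr rfl fun i' _ => Finset.sum_congr rfl fun k' _ => ?_
    simp only [Finsupp.equivFunOnFinite_symm_apply_apply, cons_val_zero, cons_val]
    split_ifs with h2 h3
    · rw [Polynomial.coeff_monomial, if_pos h3]
    · rw [Polynomial.coeff_monomial, if_neg h3]
    · simp
  rw [h1]
  split_ifs with h
  · rw [Finset.sum_eq_single ⟨i, h.1⟩, Finset.sum_eq_single ⟨k, h.2⟩]
    · simp
    · intro k' _ hk'
      rw [if_neg fun hh => hk' (Fin.ext hh)]
    · simp
    · intro i' _ hi'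
      refine Finset.sum_eq_zero fun k' _ => ?_
      rw [if_neg (c := (i' : ℕ) = i) fun hh => hi' (Fin.ext hh), ite_self]
    · simp
  · refine Finset.sum_eq_zero fun i' _ => Finset.sum_eq_zero fun k' _ => ?_
    split_ifs <;> first | rfl | omega

lemma coeffMat_dehomog_formOfMat (r s : ℕ) (B : Matrix (Fin s) (Fin s) ℝ) :
    coeffMat s (dehomog (formOfMat r s B)) = B := by
  ext i k
  rw [coeffMat, of_apply, coeff_dehomog_formOfMat, dif_pos ⟨(Fin.rev i).2, (Fin.rev k).2⟩,
    neg_neg, Fin.eta, Fin.eta, Fin.rev_rev, Fin.rev_rev]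

lemma formOfMat_injective (r s : ℕ) : Function.Injective (formOfMat r s) :=
  Function.LeftInverse.injective (g := fun f => coeffMat s (dehomog f))
    (coeffMat_dehomog_formOfMat r s)

/-- Exchanging `x` and `z` transposes the coefficient matrix, so the two ideals factor the same
matrix as `U X` and as `(U Y)ᵀ`. The bound `s ≤ n + 1` makes every `s × s` matrix a form of degree
`r`. -/
lemma mem_splineK_iff_exists_mat {r n s : ℕ} (hr : r + 1 = n + s) (hns : n ≤ s)
    (hsn : s ≤ n + 1) {U : Matrix (Fin s) (Fin s) ℝ} (hU : RepresentsLowCoeff r n U)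
    {f : MvPolynomial (Fin 3) ℝ} :
    f ∈ splineK r ↔ ∃ X Y : Matrix (Fin s) (Fin s) ℝ,
      X.IsUpperTriangular ∧ Y.IsUpperTriangular ∧ U * X = Yᵀ * Uᵀ ∧ formOfMat r s (U * X) = f := by
  rw [mem_splineK_iff]
  constructor
  · rintro ⟨hf, hx, hz⟩
    have hd : ∀ i k, r < i + k → ((dehomog f).coeff k).coeff i = 0 :=
      fun i k => coeff_dehomog_eq_zero hf
    have h0 : ∀ i k, s ≤ i ∨ s ≤ k → ((dehomog f).coeff k).coeff i = 0 := by
      rintro i k (h | h)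
      · rw [← coeff_coeff_bivariate_swap]
        refine coeff_eq_zero_of_forall_exists_dvd hr hns (fun i k h => ?_) hz h
        rw [coeff_coeff_bivariate_swap]
        exact hd k i (by omega)
      · exact coeff_eq_zero_of_forall_exists_dvd hr hns hd hx h
    obtain ⟨X, hX, hUX⟩ := (forall_exists_dvd_iff hr hU h0).mp hx
    obtain ⟨Y, hY, hUY⟩ := (forall_exists_dvd_iff hr hU fun i k h => by
      rw [coeff_coeff_bivariate_swap]
      exact h0 k i h.symm).mp hz
    rw [coeffMat_swap] at hUY
    refine ⟨X, Y, hX, hY, ?_, ?_⟩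
    · rw [hUX, ← transpose_mul, hUY, transpose_transpose]
    · refine dehomog_injective_of_isHomogeneous (isHomogeneous_formOfMat (by omega) _) hf ?_
      ext k i
      rw [coeff_dehomog_formOfMat]
      split_ifs with h
      · rw [hUX, coeffMat, of_apply, neg_neg, Fin.rev_rev, Fin.rev_rev]
      · exact (h0 i k (by omega)).symm
  · rintro ⟨X, Y, hX, hY, hXY, rfl⟩
    have h0 : ∀ i k, s ≤ i ∨ s ≤ k →
        ((dehomog (formOfMat r s (U * X))).coeff k).coeff i = 0 := by
      intro i k h
      rw [coeff_dehomog_formOfMat, dif_neg (by omega)]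
    refine ⟨isHomogeneous_formOfMat (by omega) _,
      (forall_exists_dvd_iff hr hU h0).mpr ⟨X, hX, (coeffMat_dehomog_formOfMat r s _).symm⟩,
      (forall_exists_dvd_iff hr hU fun i k h => ?_).mpr ⟨Y, hY, ?_⟩⟩
    · rw [coeff_coeff_bivariate_swap]
      exact h0 k i h.symm
    · rw [coeffMat_swap, coeffMat_dehomog_formOfMat, hXY, ← transpose_mul, transpose_transpose]

/-! ### The dimension count -/

/-- The space of upper-triangular matrices. -/
noncomputable def upperTriangularSubmodule (s : ℕ) : Submodule ℝ (Matrix (Fin s) (Fin s) ℝ) where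
  carrier := {X | X.IsUpperTriangular}
  zero_mem' := fun _ _ _ => rfl
  add_mem' := fun hX hY _ _ h => by rw [Matrix.add_apply, hX h, hY h, add_zero]
  smul_mem' := fun c _ hX _ _ h => by rw [Matrix.smul_apply, hX h, smul_zero]

/-- An upper-triangular matrix is given by its entries on and above the diagonal. -/
noncomputable def upperTriangularEquiv (s : ℕ) :
    upperTriangularSubmodule s ≃ₗ[ℝ] ({p : Fin s × Fin s // p.1 ≤ p.2} → ℝ) where
  toFun X p := X.1 p.1.1 p.1.2
  map_add' _ _ := rfl
  map_smul' _ _ := rfl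
  invFun v := ⟨Matrix.of fun i j => if h : i ≤ j then v ⟨(i, j), h⟩ else 0,
    fun _ _ h => dif_neg (not_le.mpr h)⟩
  left_inv X := by
    ext i j
    by_cases h : i ≤ j
    · simp [h]
    · simpa [h] using (X.2 (not_le.mp h)).symm
  right_inv v := by
    ext p
    exact dif_pos p.2

lemma two_mul_finrank_upperTriangularSubmodule (s : ℕ) :
    2 * Module.finrank ℝ (upperTriangularSubmodule s) = s * s + s := by
  rw [(upperTriangularEquiv s).finrank_eq, Module.finrank_fintype_fun_eq_card]
  have e : {p : Fin s × Fin s // p.1 ≤ p.2} ≃ Σ j : Fin s, {i : Fin s // i ≤ j} :=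
    { toFun := fun p => ⟨p.1.2, p.1.1, p.2⟩
      invFun := fun q => ⟨(q.2.1, q.1), q.2.2⟩
      left_inv := fun _ => rfl
      right_inv := fun _ => rfl }
  rw [Fintype.card_congr e, Fintype.card_sigma]
  have : ∀ j : Fin s, Fintype.card {i : Fin s // i ≤ j} = (j : ℕ) + 1 := by
    intro j
    rw [Fintype.card_subtype, ← Fin.card_Iic j]
    congr 1
    ext i
    simp
  simp only [this]
  rw [Fin.sum_univ_eq_sum_range (fun j => j + 1)]
  clear * -
  induction s with
  | zero => rfl
  | succ s ih =>
    rw [Finset.sum_range_succ]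
    linarith

/-- The operator `(X, Y) ↦ U X - Yᵀ Uᵀ` on pairs of upper-triangular matrices. -/
noncomputable def rothMap {s : ℕ} (U : Matrix (Fin s) (Fin s) ℝ) :
    (upperTriangularSubmodule s × upperTriangularSubmodule s) →ₗ[ℝ] Matrix (Fin s) (Fin s) ℝ where
  toFun p := U * p.1.1 - (p.2.1)ᵀ * Uᵀ
  map_add' p q := by
    simp only [Prod.fst_add, Prod.snd_add, Submodule.coe_add, transpose_add, Matrix.mul_add,
      Matrix.add_mul]
    abel
  map_smul' c p := by
    simp [smul_sub]

lemma rothSolvable_iff_surjective {s : ℕ} (U : Matrix (Fin s) (Fin s) ℝ) :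
    RothSolvable U ↔ Function.Surjective (rothMap U) := by
  refine forall_congr' fun C => ⟨?_, ?_⟩
  · rintro ⟨X, Y, hX, hY, h⟩
    exact ⟨(⟨X, hX⟩, ⟨Y, hY⟩), h⟩
  · rintro ⟨p, h⟩
    exact ⟨p.1.1, p.2.1, p.1.2, p.2.2, h⟩

/-- Rank-nullity: the domain has dimension `s² + s` and the target `s²`, so nullity `s` means full
rank. -/
lemma finrank_ker_rothMap_eq_iff {s : ℕ} (U : Matrix (Fin s) (Fin s) ℝ) :
    Module.finrank ℝ (LinearMap.ker (rothMap U)) = s ↔ RothSolvable U := by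
  rw [rothSolvable_iff_surjective, ← LinearMap.range_eq_top]
  have h1 := (rothMap U).finrank_range_add_finrank_ker
  have h2 := two_mul_finrank_upperTriangularSubmodule s
  have h3 : Module.finrank ℝ (Matrix (Fin s) (Fin s) ℝ) = s * s := by
    simp [Module.finrank_matrix]
  rw [Module.finrank_prod] at h1
  constructor
  · intro h
    exact Submodule.eq_top_of_finrank_eq (by omega)
  · intro h
    rw [h, finrank_top] at h1
    omega

/-- The form attached to a pair `(X, Y)` with `U X = Yᵀ Uᵀ`. -/
noncomputable def kerRothMapToForm (r : ℕ) {s : ℕ} (U : Matrix (Fin s) (Fin s) ℝ) :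
    LinearMap.ker (rothMap U) →ₗ[ℝ] MvPolynomial (Fin 3) ℝ :=
  formOfMat r s ∘ₗ LinearMap.mulLeft ℝ U ∘ₗ (upperTriangularSubmodule s).subtype ∘ₗ
    LinearMap.fst ℝ _ _ ∘ₗ (LinearMap.ker (rothMap U)).subtype

/-- The form only records `U X`; invertibility of `U` recovers `X` from it, and then `Y` from `U Y =
(U X)ᵀ`. -/
lemma kerRothMapToForm_injective (r : ℕ) {s : ℕ} {U : Matrix (Fin s) (Fin s) ℝ}
    (hU : IsUnit U) : Function.Injective (kerRothMapToForm r U) := by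
  refine (injective_iff_map_eq_zero _).mpr ?_
  rintro ⟨⟨⟨X, hX⟩, ⟨Y, hY⟩⟩, hXY⟩ h
  have h1 : U * X = 0 := formOfMat_injective r s (h.trans (map_zero _).symm)
  have h2 : U * X - Yᵀ * Uᵀ = 0 := hXY
  have hX0 : X = 0 := hU.mul_left_cancel (by rw [h1, Matrix.mul_zero])
  have hY0 : Y = 0 := by
    refine hU.mul_left_cancel ?_
    rw [h1, zero_sub, neg_eq_zero, ← transpose_mul, transpose_eq_zero] at h2
    rw [h2, Matrix.mul_zero]
  subst hX0 hY0
  rfl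

lemma range_kerRothMapToForm {r n s : ℕ} (hr : r + 1 = n + s) (hns : n ≤ s)
    (hsn : s ≤ n + 1) {U : Matrix (Fin s) (Fin s) ℝ} (hU : RepresentsLowCoeff r n U) :
    LinearMap.range (kerRothMapToForm r U) = splineK r := by
  ext f
  rw [mem_splineK_iff_exists_mat hr hns hsn hU, LinearMap.mem_range]
  constructor
  · rintro ⟨⟨⟨⟨X, hX⟩, ⟨Y, hY⟩⟩, hXY⟩, h⟩
    exact ⟨X, Y, hX, hY, sub_eq_zero.mp hXY, h⟩
  · rintro ⟨X, Y, hX, hY, hXY, h⟩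
    exact ⟨⟨(⟨X, hX⟩, ⟨Y, hY⟩), sub_eq_zero.mpr hXY⟩, h⟩

lemma finrank_splineK_eq_iff {r n s : ℕ} (hr : r + 1 = n + s) (hns : n ≤ s)
    (hsn : s ≤ n + 1) {U : Matrix (Fin s) (Fin s) ℝ} (hU : RepresentsLowCoeff r n U) :
    Module.finrank ℝ (splineK r) = s ↔ RothSolvable U := by
  rw [← range_kerRothMapToForm hr hns hsn hU, LinearMap.finrank_range_of_inj
    (kerRothMapToForm_injective r (isUnit_of_representsLowCoeff hU)),
    finrank_ker_rothMap_eq_iff]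

theorem proposition3p4 (n : ℕ) (hn : 1 ≤ n) :
    (IsUnit (binomN (2 * n - 1) n) ∧
      (Module.finrank ℝ (splineK (2 * n - 1)) = n ↔ RothSolvable (rothUOdd n))) ∧
    (IsUnit (binomN (2 * n) n) ∧
      (Module.finrank ℝ (splineK (2 * n)) = n + 1 ↔ RothSolvable (rothUEven n))) := by
  have h1 : 2 * n - 1 + 1 = n + n := by omega
  have h2 : 2 * n + 1 = n + (n + 1) := by omega
  exact ⟨⟨isUnit_binomN h1 le_rfl,
      finrank_splineK_eq_iff h1 le_rfl (Nat.le_succ n) (representsLowCoeff_rothUOdd hn)⟩,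
    isUnit_binomN h2 (Nat.le_succ n),
      finrank_splineK_eq_iff h2 (Nat.le_succ n) le_rfl (representsLowCoeff_rothUEven n)⟩
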